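/- Let $G=(V,D,B)$ be a finite mixed graph with directed edges $v\to w\in D$ (no self-loops) and bidirected edges $v\leftrightarrow w\in B$. Assume that $G$ is ancestral: it has no directed cycle, and $v\leftrightarrow w\in B$ implies that there is no directed path from $v$ to $w$ or from $w$ to $v$. Write $\mathrm{pa}(v)$ for the set of parents of $v$ and $\mathrm{htr}(v)$ for the set of nodes reachable from $v$ by a half-trek (a directed path, except that its first edge may instead be bidirected). Let $R=\mathbb{R}[\sigma_{vw}=\sigma_{wv} : v,w\in V]$ and let $\Sigma=(\sigma_{vw})$ be the symbolic symmetric matrix. A graphical constraint is a bipartite graph whose nodes are labelled with subsets of $V$. It represents, up to sign, the determinant of the matrix (required to be square) with a row for each pair $(a,v)$, $a$ a node of the first part and $v$ in its label, a column for each pair $(b,w)$, $b$ a node of the second part and $w$ in its label, and the entry $\sigma_{vw}$ if $a,b$ are adjacent and $0$ otherwise. Given sets $(Y_v)_{v\in V}$ and a pair $v\ne w$ with $v\leftrightarrow w\notin B$, $v\notin Y_w$, $w\notin Y_v$, the HTC-based construction produces a graphical constraint as follows. Start with two adjacent nodes labelled $\{v\}$ and $\{w\}$ and expand both, where expanding a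 node $t$ with label $\{u\}$ means: replace its label by $\{u\}\cup\mathrm{pa}(u)$, attach to $t$ a new node $t_y$ with label $\{y\}$ for each $y\in Y_u$, and expand $t_y$ recursively for each $y\in Y_u\cap\mathrm{htr}(u)$. Finally, wherever several leaves are attached to the same node, merge them into one leaf labelled with the union of their labels. Let $I\subseteq R$ be the ideal generated by the polynomials represented by the outputs of this construction with $Y_v=\mathrm{pa}(v)$ for every $v$, over all admissible pairs $\{v,w\}$. Let $\mathcal{M}(G)$ be the set of matrices $(I-\Lambda)^{-T}\Omega(I-\Lambda)^{-1}$ with $\Lambda$ real, $\Lambda_{vw}=0$ unless $v\to w\in D$, $I-\Lambda$ invertible, and $\Omega$ positive definite with $\Omega_{vw}=0$ unless $v=w$ or $v\leftrightarrow w\in B$. Let $\overline{\mathcal{M}(G)}$ be its Zariski closure in the space of real symmetric matrices. Call a component of a minimal primary decomposition of $I$ spurious if its real variety is different from $\overline{\mathcal{M}(G)}$. Then $I$ is PD-primary: in every minimal primary decomposition of $I$, every spurious component contains a positive power of a (nonempty) principal minor of $\Sigma$. Moreover, in every minimal primary decomposition of $I$ there is exactly one component whose variety is $\overline{\mathcal{M}(G)}$,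 so the spurious components are precisely the remaining ones, and the variety of each spurious component contains no positive definite matrix. -/

import Mathlib

/-- A mixed graph `(V, D, B)`: directed edges `v → w` (no self-loops; directed cycles and bows are
allowed) and bidirected edges `v ↔ w`. -/
structure MixedGraph (V : Type*) where
  /-- `D v w` means `v → w`. -/
  D : V → V → Prop
  D_irrefl : ∀ v, ¬ D v v
  /-- `B.Adj v w` means `v ↔ w`. -/
  B : SimpleGraph V

namespace MixedGraph

variable {V : Type*}

/-- The parents of `v`. -/
def pa (G : MixedGraph V) (v : V) : Set V := {p | G.D p v}

/-- The graph has no directed cycle, and no node is joined by a bidirected edge to a proper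
ancestor of it. -/
def IsAncestral (G : MixedGraph V) : Prop :=
  (∀ v, ¬ Relation.TransGen G.D v v) ∧ ∀ v w, G.B.Adj v w → ¬ Relation.TransGen G.D v w

/-- The nodes reachable from `v` by a half-trek, i.e. by a path that is directed except that its
first edge may instead be bidirected. -/
def htr (G : MixedGraph V) (v : V) : Set V :=
  {w | Relation.ReflTransGen G.D v w ∨ ∃ x, G.B.Adj v x ∧ Relation.ReflTransGen G.D x w}

end MixedGraph

/-! ### Covariance matrices with symbolic entries -/

namespace CovPoly

variable {V : Type*}

/-- The symbolic symmetric matrix `Σ`: the polynomial ring has one variable `σ_{vw} = σ_{wv}` for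
each unordered pair (possibly with `v = w`). -/
noncomputable def sigma (V : Type*) : Matrix V V (MvPolynomial (Sym2 V) ℝ) :=
  Matrix.of fun v w => MvPolynomial.X s(v, w)

/-- The real symmetric matrix with the coordinates `x`. -/
def toMatrix (x : Sym2 V → ℝ) : Matrix V V ℝ := Matrix.of fun v w => x s(v, w)

/-- The principal minor of `Σ` with rows and columns `S`. -/
noncomputable def principalMinor [DecidableEq V] (S : Finset V) : MvPolynomial (Sym2 V) ℝ :=
  ((sigma V).submatrix (fun i : S => (i : V)) (fun i : S => (i : V))).det

/-- The positive definite cone. -/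
def posDefCone (V : Type*) : Set (Sym2 V → ℝ) := {x | (toMatrix x).PosDef}

end CovPoly

/-! ### The linear structural equation model of a mixed graph -/

namespace MixedGraph

variable {V : Type*} [Fintype V] [DecidableEq V]

/-- The covariance matrices `(I - Λ)⁻ᵀ Ω (I - Λ)⁻¹`, where `Λ` is supported on the directed edges
with `I - Λ` invertible, and `Ω` is positive definite and supported on the diagonal and the
bidirected edges. -/
def model (G : MixedGraph V) : Set (Sym2 V → ℝ) :=
  {x | ∃ Λ Ω : Matrix V V ℝ,
    (∀ v w, ¬ G.D v w → Λ v w = 0) ∧ IsUnit (1 - Λ) ∧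
    (∀ v w, v ≠ w → ¬ G.B.Adj v w → Ω v w = 0) ∧ Ω.PosDef ∧
    CovPoly.toMatrix x = ((1 - Λ)⁻¹).transpose * Ω * (1 - Λ)⁻¹}

/-- The Zariski closure `V(I_G)` of the model, `I_G` being the ideal of polynomials that vanish on
the model. -/
noncomputable def algebraicModel (G : MixedGraph V) : Set (Sym2 V → ℝ) :=
  MvPolynomial.zeroLocus ℝ (MvPolynomial.vanishingIdeal ℝ G.model)

end MixedGraph

/-! ### Graphical constraints -/

/-- A bipartite graph with parts `A`, `B` whose nodes are labelled with sets of variables. -/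
structure GraphicalConstraint.{u} (V : Type u) where
  A : Type u
  B : Type u
  labelA : A → Set V
  labelB : B → Set V
  Adj : A → B → Prop

namespace GraphicalConstraint

variable {V : Type*}

/-- Row indices: pairs of a node in `A` and an element of its label. -/
def Row (C : GraphicalConstraint V) : Type _ := {p : C.A × V // p.2 ∈ C.labelA p.1}

/-- Column indices: pairs of a node in `B` and an element of its label. -/
def Col (C : GraphicalConstraint V) : Type _ := {p : C.B × V // p.2 ∈ C.labelB p.1}

open Classical in
/-- The matrix of a graphical constraint. -/
noncomputable def matrix (C : GraphicalConstraint V) :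
    Matrix C.Row C.Col (MvPolynomial (Sym2 V) ℝ) :=
  Matrix.of fun r c => if C.Adj r.1.1 c.1.1 then CovPoly.sigma V r.1.2 c.1.2 else 0

/-- `f` is the determinant of the (finite, square) matrix of `C`, for some ordering of the rows and
some ordering of the columns; so `f` is determined by `C` up to sign. -/
def Represents (C : GraphicalConstraint V) (f : MvPolynomial (Sym2 V) ℝ) : Prop :=
  ∃ (n : ℕ) (r : Fin n ≃ C.Row) (c : Fin n ≃ C.Col), f = (C.matrix.submatrix r c).det

/-- `b` is the one and only neighbour of `a`; so `a` is a leaf attached to `b`. -/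
def LeafA (C : GraphicalConstraint V) (a : C.A) (b : C.B) : Prop := ∀ b', C.Adj a b' ↔ b' = b

/-- `a` is the one and only neighbour of `b`; so `b` is a leaf attached to `a`. -/
def LeafB (C : GraphicalConstraint V) (b : C.B) (a : C.A) : Prop := ∀ a', C.Adj a' b ↔ a' = a

/-- Two nodes in `A` are merged if they are equal or are leaves attached to the same node. -/
def mergeA (C : GraphicalConstraint V) : Setoid C.A where
  r a a' := a = a' ∨ ∃ b, C.LeafA a b ∧ C.LeafA a' b
  iseqv :=
    { refl := fun _ => Or.inl rfl
      symm := by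
        rintro a a' (h | ⟨b, h, h'⟩)
        · exact Or.inl h.symm
        · exact Or.inr ⟨b, h', h⟩
      trans := by
        rintro a a' a'' (rfl | ⟨b, h, h'⟩) (rfl | ⟨c, k, k'⟩)
        · exact Or.inl rfl
        · exact Or.inr ⟨c, k, k'⟩
        · exact Or.inr ⟨b, h, h'⟩
        · have hbc : b = c := (k b).1 ((h' b).2 rfl)
          subst hbc
          exact Or.inr ⟨b, h, k'⟩ }

/-- Two nodes in `B` are merged if they are equal or are leaves attached to the same node. -/
def mergeB (C : GraphicalConstraint V) : Setoid C.B where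
  r b b' := b = b' ∨ ∃ a, C.LeafB b a ∧ C.LeafB b' a
  iseqv :=
    { refl := fun _ => Or.inl rfl
      symm := by
        rintro b b' (h | ⟨a, h, h'⟩)
        · exact Or.inl h.symm
        · exact Or.inr ⟨a, h', h⟩
      trans := by
        rintro b b' b'' (rfl | ⟨a, h, h'⟩) (rfl | ⟨c, k, k'⟩)
        · exact Or.inl rfl
        · exact Or.inr ⟨c, k, k'⟩
        · exact Or.inr ⟨a, h, h'⟩
        · have hac : a = c := (k a).1 ((h' a).2 rfl)
          subst hac
          exact Or.inr ⟨a, h, k'⟩ }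

/-- Wherever two or more leaves are attached to the same node, merge them into a single leaf
labelled with the union of their labels. -/
def mergeLeaves (C : GraphicalConstraint V) : GraphicalConstraint V where
  A := Quotient C.mergeA
  B := Quotient C.mergeB
  labelA q := {x | ∃ a, Quotient.mk C.mergeA a = q ∧ x ∈ C.labelA a}
  labelB q := {x | ∃ b, Quotient.mk C.mergeB b = q ∧ x ∈ C.labelB b}
  Adj q q' := ∃ a b, Quotient.mk C.mergeA a = q ∧ Quotient.mk C.mergeB b = q' ∧ C.Adj a b

end GraphicalConstraint

/-! ### The construction algorithm

Input: a mixed graph `G`, a family `Y` of sets of nodes, and a pair of nodes `v`, `w`. -/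

namespace Construction

/-- Names for the nodes of the tree grown by the algorithm: the two seeds, and the node created
for the variable `y` during the expansion of the node `t`. -/
inductive Node (V : Type*) where
  | seed₁ : Node V
  | seed₂ : Node V
  | child (t : Node V) (y : V) : Node V

variable {V : Type*}

/-- The variable in the initial (singleton) label of a node. -/
def Node.var (v w : V) : Node V → V
  | .seed₁ => v
  | .seed₂ => w
  | .child _ y => y

/-- The part of the bipartition in which a node lies. -/
def Node.side : Node V → Bool
  | .seed₁ => false
  | .seed₂ => true
  | .child t _ => !t.side

/-- The nodes on which the subroutine `expand` is called: both seeds, and during the expansion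
of `t` (with variable `u`) the new nodes for those `y ∈ Y u` with `y ∈ htr u`. -/
inductive Expanded (G : MixedGraph V) (Y : V → Set V) (v w : V) : Node V → Prop
  | seed₁ : Expanded G Y v w .seed₁
  | seed₂ : Expanded G Y v w .seed₂
  | child {t : Node V} {y : V} : Expanded G Y v w t → y ∈ Y (t.var v w) →
      y ∈ G.htr (t.var v w) → Expanded G Y v w (.child t y)

/-- The nodes that are created: both seeds, and during the expansion of `t` (with variable `u`) one
new node for each `y ∈ Y u`. -/
inductive Created (G : MixedGraph V) (Y : V → Set V) (v w : V) : Node V → Prop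
  | seed₁ : Created G Y v w .seed₁
  | seed₂ : Created G Y v w .seed₂
  | child {t : Node V} {y : V} : Expanded G Y v w t → y ∈ Y (t.var v w) →
      Created G Y v w (.child t y)

/-- The final label of a node: `{u}`, replaced by `{u} ∪ pa(u)` if the node is expanded. -/
def label (G : MixedGraph V) (Y : V → Set V) (v w : V) (t : Node V) : Set V :=
  {x | x = t.var v w ∨ (Expanded G Y v w t ∧ x ∈ G.pa (t.var v w))}

/-- The edges: the two seeds are joined, and each new node is attached to the node whose expansion
created it. -/
def Joined (s t : Node V) : Prop :=
  (s = .seed₁ ∧ t = .seed₂) ∨ (∃ y, t = .child s y) ∨ (∃ y, s = .child t y)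

/-- The tree obtained after all expansions. -/
def tree (G : MixedGraph V) (Y : V → Set V) (v w : V) : GraphicalConstraint V where
  A := {t : Node V // Created G Y v w t ∧ t.side = false}
  B := {t : Node V // Created G Y v w t ∧ t.side = true}
  labelA t := label G Y v w t.1
  labelB t := label G Y v w t.1
  Adj s t := Joined s.1 t.1

/-- The output of the algorithm: the tree with leaves at the same node merged. -/
def output (G : MixedGraph V) (Y : V → Set V) (v w : V) : GraphicalConstraint V :=
  (tree G Y v w).mergeLeaves

end Construction

namespace MixedGraph

variable {V : Type*}

/-- The ideal generated by the polynomials represented by the outputs of the algorithm, for all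
pairs `v ≠ w` with `v ↔ w ∉ B`, `v ∉ Y w` and `w ∉ Y v`. -/
noncomputable def constraintIdeal (G : MixedGraph V) (Y : V → Set V) : Ideal (MvPolynomial (Sym2 V) ℝ) :=
  Ideal.span {f | ∃ v w, v ≠ w ∧ ¬ G.B.Adj v w ∧ v ∉ Y w ∧ w ∉ Y v ∧
    (Construction.output G Y v w).Represents f}

/-- A component of a primary decomposition is spurious if its variety is not the algebraic
model. -/
def IsSpurious [Fintype V] [DecidableEq V] (G : MixedGraph V)
    (Q : Ideal (MvPolynomial (Sym2 V) ℝ)) : Prop :=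
  MvPolynomial.zeroLocus ℝ Q ≠ G.algebraicModel

/-- In every minimal primary decomposition of `I`, each spurious component contains a power of a
principal minor of `Σ`. -/
def IsPDPrimary [Fintype V] [DecidableEq V] (G : MixedGraph V)
    (I : Ideal (MvPolynomial (Sym2 V) ℝ)) : Prop :=
  ∀ t : Finset (Ideal (MvPolynomial (Sym2 V) ℝ)), Submodule.IsMinimalPrimaryDecomposition I t →
    ∀ Q ∈ t, G.IsSpurious Q →
      ∃ S : Finset V, S.Nonempty ∧ ∃ k : ℕ, 1 ≤ k ∧ CovPoly.principalMinor S ^ k ∈ Q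

end MixedGraph

/-! In an ancestral graph no parent of `u` is half-trek reachable from `u`, so with `Y = pa` only
the two seeds are expanded. The output matrix then has rows `v, pa(v), pa(w)`, columns `w, pa(v),
pa(w)` and one zero block. Let `Λ` solve the normal equations of regressing each node on its
parents. By `det_hookMatrix` the determinant is the product of the principal minors of `pa(v)` and
`pa(w)` and the entry of `Ω = (1 - Λ)ᵀ Σ (1 - Λ)` at `(v, w)`.

Let `s` be the product of all parent minors. Once `s` is inverted, `Λ` exists and the constraints
force `Ω` to have the support prescribed by `G`; pairs joined by a directed edge are handled by
induction along ancestors. Hence `R → (R/I)_s` factors through the polynomial parametrization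
`paramHom`, whose kernel is the vanishing ideal `P` of the model. So `P` is prime and equals the
saturation `I : s^∞` (`mem_vanishingIdeal_model_iff`).

It follows that `P` is a component of every minimal primary decomposition and that every other
component contains a power of `s`, hence of one parent minor. Principal minors are nonzero on
positive definite matrices, so the other components miss the positive definite cone, while the model
is nonempty and lies inside it. -/

/-! ### Primary decompositions of ideals with prime saturation -/

/-- If the saturation `P` of `I` with respect to `s` is prime, then `P` is a component of every
minimal primary decomposition of `I`, and all other components contain a power of `s`. -/
theorem Submodule.IsMinimalPrimaryDecomposition.mem_and_mem_radical_of_saturation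
    {R : Type*} [CommRing R] {I P : Ideal R} {t : Finset (Ideal R)}
    (ht : Submodule.IsMinimalPrimaryDecomposition I t) (hP : P.IsPrime) {s : R}
    (hs : ∀ f, f ∈ P ↔ ∃ n : ℕ, s ^ n * f ∈ I) :
    P ∈ t ∧ ∀ Q ∈ t, Q ≠ P → s ∈ Q.radical := by
  have hIP : I ≤ P := fun f hf => (hs f).2 ⟨0, by simpa using hf⟩
  have hsP : s ∉ P := by
    intro h
    obtain ⟨n, hn⟩ := (hs s).1 h
    exact hP.ne_top ((Ideal.eq_top_iff_one _).2 ((hs 1).2 ⟨n + 1, by simpa [pow_succ] using hn⟩))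
  have hIQ : ∀ Q ∈ t, I ≤ Q := by
    intro Q hQ
    rw [← ht.inf_eq]
    exact Finset.inf_le (f := id) hQ
  have hPQ : ∀ Q ∈ t, s ∉ Q.radical → P ≤ Q := by
    intro Q hQ hsQ f hf
    obtain ⟨n, hn⟩ := (hs f).1 hf
    have h := (Ideal.isPrimary_iff.1 (ht.primary hQ)).2 (x := f) (y := s ^ n)
      (by rw [mul_comm]; exact hIQ Q hQ hn)
    refine h.resolve_right fun h' => hsQ ?_
    exact (Ideal.isPrime_radical (ht.primary hQ)).mem_of_pow_mem _ h'
  -- A prime containing a finite intersection contains one of its members.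
  obtain ⟨Q₀, hQ₀, hle⟩ := (hP.inf_le' (s := t) (f := id)).1 (ht.inf_eq.trans_le hIP)
  have hQP : Q₀ = P := le_antisymm hle
    (hPQ Q₀ hQ₀ fun h => hsP ((Ideal.IsPrime.radical_le_iff hP).2 hle h))
  subst hQP
  refine ⟨hQ₀, fun Q hQ hne => ?_⟩
  by_contra hsQ
  -- `P` is among the remaining components, so a further component containing `P` would be
  -- redundant.
  exact ht.minimal hQ ((Finset.inf_le (f := id) (Finset.mem_erase.2 ⟨hne.symm, hQ₀⟩)).trans
    (hPQ Q hQ hsQ))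

/-! ### Determinants -/

namespace Matrix

/-- Two ways of indexing a square matrix by the same type give the same determinant up to sign. -/
theorem det_submatrix_equiv_equiv_eq_or_neg {ι κ T : Type*} [Fintype ι] [DecidableEq ι]
    [Fintype κ] [DecidableEq κ] [CommRing T] (M : Matrix ι ι T) (e e' : κ ≃ ι) :
    (M.submatrix e e').det = M.det ∨ (M.submatrix e e').det = -M.det := by
  have h : M.submatrix e e' = (M.submatrix id (e.symm.trans e')).submatrix e e := by
    ext i j
    simp
  rw [h, det_submatrix_equiv_self, det_permute']
  rcases Int.units_eq_one_or (Equiv.Perm.sign (e.symm.trans e')) with h | h <;> simp [h]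

variable {V T : Type*} [CommRing T]

/-- The matrix with rows `v, P, Q` and columns `w, P, Q`, filled with the entries of `S` except for
a zero block in the rows `Q` and the columns `P`. -/
def hookMatrix (S : Matrix V V T) (v w : V) (P Q : Finset V) :
    Matrix ((Unit ⊕ P) ⊕ Q) ((Unit ⊕ P) ⊕ Q) T :=
  fromBlocks
    (fromBlocks (of fun _ _ => S v w) (of fun _ p => S v p)
      (of fun p _ => S p w) (of fun p p' => S p p'))
    (of (Sum.elim (fun _ (q : Q) => S v q) (fun p q => S p q)))
    (of fun q => Sum.elim (fun _ => S q w) (fun _ => 0))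
    (of fun q q' => S q q')

/-- Subtracting the `b`-combination of the columns `Q` from column `w` clears the rows `Q` of that
column, which splits off the block of `Q`. Subtracting the `a`-combination of the rows `P` from row
`v` then splits off the block of `P`. Only solutions `a`, `b` are needed, not invertible blocks. -/
theorem det_hookMatrix [DecidableEq V] (S : Matrix V V T) (hS : S.IsSymm) (v w : V)
    (P Q : Finset V) (a b : V → T)
    (ha : ∀ p ∈ P, S p v = ∑ u ∈ P, S p u * a u) (hb : ∀ q ∈ Q, S q w = ∑ u ∈ Q, S q u * b u) :
    (hookMatrix S v w P Q).det =
      (S.submatrix (fun i : P => (i : V)) (fun i : P => (i : V))).det *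
      (S.submatrix (fun i : Q => (i : V)) (fun i : Q => (i : V))).det *
      ((S v w - ∑ q ∈ Q, S v q * b q) - ∑ p ∈ P, a p * (S p w - ∑ q ∈ Q, S p q * b q)) := by
  let X : Matrix Q (Unit ⊕ P) T := of fun q => Sum.elim (fun _ => -b q) (fun _ => 0)
  let R : Matrix ((Unit ⊕ P) ⊕ Q) ((Unit ⊕ P) ⊕ Q) T := fromBlocks 1 0 X 1
  let L : Matrix (Unit ⊕ P) (Unit ⊕ P) T := fromBlocks 1 (of fun _ p => -a p) 0 1
  let K : Matrix (Unit ⊕ P) (Unit ⊕ P) T :=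
    fromBlocks (of fun _ _ => S v w - ∑ q ∈ Q, S v q * b q) (of fun _ p => S v p)
      (of fun p _ => S p w - ∑ q ∈ Q, S p q * b q) (of fun p p' => S p p')
  let SP : Matrix P P T := S.submatrix (fun i => i) (fun i => i)
  let SQ : Matrix Q Q T := S.submatrix (fun i => i) (fun i => i)
  have hR : R.det = 1 := by simp [R]
  have hL : L.det = 1 := by simp [L]
  have h1 : hookMatrix S v w P Q * R = fromBlocks K
      (of (Sum.elim (fun _ (q : Q) => S v q) (fun p q => S p q))) 0
      SQ := by
    simp only [hookMatrix, R, fromBlocks_multiply]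
    congr 1
    · ext i j
      rcases i with i | i <;> rcases j with j | j <;>
        simp [K, X, mul_apply, sub_eq_add_neg, ← Finset.sum_coe_sort Q]
    · simp
    · ext i j
      rcases j with j | j
      · simp [X, mul_apply, hb i i.2, ← Finset.sum_coe_sort Q]
      · simp [X, mul_apply]
    · ext i j
      simp [SQ]
  have h2 : L * K = fromBlocks
      (of fun _ _ => (S v w - ∑ q ∈ Q, S v q * b q) -
        ∑ p ∈ P, a p * (S p w - ∑ q ∈ Q, S p q * b q)) 0
      (of fun (p : P) _ => S p w - ∑ q ∈ Q, S p q * b q)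
      SP := by
    simp only [L, K, fromBlocks_multiply]
    congr 1
    · ext i j
      simp [mul_apply, sub_eq_add_neg, ← Finset.sum_coe_sort P]
    · ext i j
      simp only [Matrix.one_mul, add_apply, mul_apply, of_apply, zero_apply]
      rw [hS.apply, ha j j.2, ← Finset.sum_coe_sort P, ← Finset.sum_add_distrib]
      refine Finset.sum_eq_zero fun x _ => ?_
      rw [hS.apply]
      ring
    · ext i j
      simp
    · ext i j
      simp [SP]
  have h3 := congrArg det h1
  have h4 := congrArg det h2
  rw [det_mul, hR, mul_one, det_fromBlocks_zero₂₁] at h3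
  rw [det_mul, hL, one_mul, det_fromBlocks_zero₁₂] at h4
  rw [h3, h4]
  simp only [det_unique, of_apply]
  ring

end Matrix

/-! ### Uniqueness up to sign of the represented polynomial -/

namespace GraphicalConstraint

variable {V ι : Type*} [Fintype ι] [DecidableEq ι] {C : GraphicalConstraint V}

theorem represents_det_submatrix (r : ι ≃ C.Row) (c : ι ≃ C.Col) :
    C.Represents (C.matrix.submatrix r c).det := by
  refine ⟨Fintype.card ι, (Fintype.equivFin ι).symm.trans r, (Fintype.equivFin ι).symm.trans c, ?_⟩
  rw [← Matrix.det_submatrix_equiv_self (Fintype.equivFin ι).symm]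
  rfl

theorem Represents.eq_or_neg (r : ι ≃ C.Row) (c : ι ≃ C.Col) {f : MvPolynomial (Sym2 V) ℝ}
    (hf : C.Represents f) :
    f = (C.matrix.submatrix r c).det ∨ f = -(C.matrix.submatrix r c).det := by
  obtain ⟨n, r', c', rfl⟩ := hf
  have h : C.matrix.submatrix r' c' = (C.matrix.submatrix r c).submatrix
      (r'.trans r.symm) (c'.trans c.symm) := by
    ext i j
    simp
  rw [h]
  exact Matrix.det_submatrix_equiv_equiv_eq_or_neg _ _ _

end GraphicalConstraint

/-! ### The output of the construction for an ancestral graph and `Y = pa` -/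

namespace MixedGraph

variable {V : Type*} (G : MixedGraph V)

/-- A directed half-trek from `u` to a parent closes up to a cycle; one starting with `u ↔ x` makes
`x` a proper ancestor of `u`. -/
theorem IsAncestral.notMem_htr {G : MixedGraph V} (hG : G.IsAncestral) {u y : V}
    (h : y ∈ G.pa u) : y ∉ G.htr u := by
  rintro (h' | ⟨x, hx, h'⟩)
  · exact hG.1 u (Relation.TransGen.tail' h' h)
  · exact hG.2 x u hx.symm (Relation.TransGen.tail' h' h)

/-- The parents of `v` as a finite set. -/
noncomputable def parents [Fintype V] (v : V) : Finset V := (Set.toFinite (G.pa v)).toFinset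

variable {G}

@[simp]
theorem mem_parents [Fintype V] {u v : V} : u ∈ G.parents v ↔ G.D u v := by
  simp [parents, pa]

end MixedGraph

namespace Construction

variable {V : Type*} {G : MixedGraph V} {v w : V}

theorem expanded_pa_iff (hG : G.IsAncestral) {t : Node V} :
    Expanded G G.pa v w t ↔ t = .seed₁ ∨ t = .seed₂ := by
  constructor
  · rintro (_ | _ | ⟨_, h, h'⟩)
    · exact Or.inl rfl
    · exact Or.inr rfl
    · exact absurd h' (hG.notMem_htr h)
  · rintro (rfl | rfl)
    · exact .seed₁
    · exact .seed₂

theorem created_pa_cases (hG : G.IsAncestral) {t : Node V} (h : Created G G.pa v w t) :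
    t = .seed₁ ∨ t = .seed₂ ∨ (∃ p, G.D p v ∧ t = .child .seed₁ p) ∨
      ∃ q, G.D q w ∧ t = .child .seed₂ q := by
  rcases h with _ | _ | ⟨h, h'⟩
  · exact Or.inl rfl
  · exact Or.inr (Or.inl rfl)
  · rcases (expanded_pa_iff hG).1 h with rfl | rfl
    · exact Or.inr (Or.inr (Or.inl ⟨_, h', rfl⟩))
    · exact Or.inr (Or.inr (Or.inr ⟨_, h', rfl⟩))

/-- For an ancestral graph and `Y = pa`, the matrix of the output is a hook matrix. -/
theorem exists_output_matrix_eq [Fintype V] (hG : G.IsAncestral) (hvw : ¬ G.D v w)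
    (hwv : ¬ G.D w v) :
    ∃ (r : (Unit ⊕ G.parents v) ⊕ G.parents w ≃ (output G G.pa v w).Row)
      (c : (Unit ⊕ G.parents v) ⊕ G.parents w ≃ (output G G.pa v w).Col),
      (output G G.pa v w).matrix.submatrix r c =
        (CovPoly.sigma V).hookMatrix v w (G.parents v) (G.parents w) := by
  let C := tree G G.pa v w
  have e₁ : Expanded G G.pa v w .seed₁ := .seed₁
  have e₂ : Expanded G G.pa v w .seed₂ := .seed₂
  let s₁ : C.A := ⟨.seed₁, .seed₁, rfl⟩
  let s₂ : C.B := ⟨.seed₂, .seed₂, rfl⟩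
  let a : G.parents w → C.A := fun q => ⟨.child .seed₂ q, .child e₂ (MixedGraph.mem_parents.1 q.2), rfl⟩
  let b : G.parents v → C.B := fun p => ⟨.child .seed₁ p, .child e₁ (MixedGraph.mem_parents.1 p.2), rfl⟩
  have hA : ∀ x : C.A, x = s₁ ∨ ∃ q, x = a q := by
    rintro ⟨x, hx, hx'⟩
    rcases created_pa_cases hG hx with rfl | rfl | ⟨p, hp, rfl⟩ | ⟨q, hq, rfl⟩
    · exact Or.inl rfl
    · cases hx'
    · cases hx'
    · exact Or.inr ⟨⟨q, MixedGraph.mem_parents.2 hq⟩, rfl⟩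
  have hB : ∀ x : C.B, x = s₂ ∨ ∃ p, x = b p := by
    rintro ⟨x, hx, hx'⟩
    rcases created_pa_cases hG hx with rfl | rfl | ⟨p, hp, rfl⟩ | ⟨q, hq, rfl⟩
    · cases hx'
    · exact Or.inl rfl
    · exact Or.inr ⟨⟨p, MixedGraph.mem_parents.2 hp⟩, rfl⟩
    · cases hx'
  have adj₁₂ : C.Adj s₁ s₂ := Or.inl ⟨rfl, rfl⟩
  have adj₁ : ∀ p, C.Adj s₁ (b p) := fun p => Or.inr (Or.inl ⟨p, rfl⟩)
  have adj₂ : ∀ q, C.Adj (a q) s₂ := fun q => Or.inr (Or.inr ⟨q, rfl⟩)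
  have adj₀ : ∀ q p, ¬ C.Adj (a q) (b p) := by
    rintro q p (⟨h, -⟩ | ⟨y, h⟩ | ⟨y, h⟩) <;> simp [a, b] at h
  have hb₂ : ∀ p, b p ≠ s₂ := fun p h => nomatch congrArg Subtype.val h
  have ha₁ : ∀ q, a q ≠ s₁ := fun q h => nomatch congrArg Subtype.val h
  -- A parent of `v` is required: without one, `s₁` is itself a leaf at `s₂` and is merged with the
  -- `a q`. Rows then stay distinct because `v ∉ pa(w)`. The same holds for `sepB` with the roles
  -- exchanged.
  have sepA : ∀ (_ : G.parents v) q, Quotient.mk C.mergeA (a q) ≠ Quotient.mk C.mergeA s₁ := by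
    intro p q h
    rcases Quotient.exact h with h | ⟨x, -, h⟩
    · exact ha₁ q h
    · exact hb₂ p (((h _).1 (adj₁ p)).trans ((h _).1 adj₁₂).symm)
  have sepB : ∀ (_ : G.parents w) p, Quotient.mk C.mergeB (b p) ≠ Quotient.mk C.mergeB s₂ := by
    intro q p h
    rcases Quotient.exact h with h | ⟨x, -, h⟩
    · exact hb₂ p h
    · exact ha₁ q (((h _).1 (adj₂ q)).trans ((h _).1 adj₁₂).symm)
  have vp : ∀ p : G.parents v, v ≠ p := fun p h =>
    G.D_irrefl v (by simpa [← h] using MixedGraph.mem_parents.1 p.2)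
  have vq : ∀ q : G.parents w, v ≠ q := fun q h =>
    hvw (by simpa [← h] using MixedGraph.mem_parents.1 q.2)
  have wp : ∀ p : G.parents v, w ≠ p := fun p h =>
    hwv (by simpa [← h] using MixedGraph.mem_parents.1 p.2)
  have wq : ∀ q : G.parents w, w ≠ q := fun q h =>
    G.D_irrefl w (by simpa [← h] using MixedGraph.mem_parents.1 q.2)
  let r : (Unit ⊕ G.parents v) ⊕ G.parents w → (output G G.pa v w).Row :=
    Sum.elim (Sum.elim (fun _ => ⟨(Quotient.mk C.mergeA s₁, v), s₁, rfl, Or.inl rfl⟩)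
      (fun p => ⟨(Quotient.mk C.mergeA s₁, p), s₁, rfl, Or.inr ⟨e₁, MixedGraph.mem_parents.1 p.2⟩⟩))
      (fun q => ⟨(Quotient.mk C.mergeA (a q), q), a q, rfl, Or.inl rfl⟩)
  let c : (Unit ⊕ G.parents v) ⊕ G.parents w → (output G G.pa v w).Col :=
    Sum.elim (Sum.elim (fun _ => ⟨(Quotient.mk C.mergeB s₂, w), s₂, rfl, Or.inl rfl⟩)
      (fun p => ⟨(Quotient.mk C.mergeB (b p), p), b p, rfl, Or.inl rfl⟩))
      (fun q => ⟨(Quotient.mk C.mergeB s₂, q), s₂, rfl, Or.inr ⟨e₂, MixedGraph.mem_parents.1 q.2⟩⟩)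
  have hr : Function.Bijective r := by
    constructor
    · rintro ((i | p) | q) ((i' | p') | q') h <;>
        replace h := Prod.ext_iff.1 (congrArg Subtype.val h)
      · rfl
      · exact absurd h.2 (vp p')
      · exact absurd h.2 (vq q')
      · exact absurd h.2.symm (vp p)
      · rw [Subtype.ext h.2]
      · exact absurd h.1.symm (sepA p q')
      · exact absurd h.2.symm (vq q)
      · exact absurd h.1 (sepA p' q)
      · rw [Subtype.ext h.2]
    · rintro ⟨⟨z, x⟩, hz⟩
      have hz' : ∃ y, Quotient.mk C.mergeA y = z ∧ x ∈ C.labelA y := hz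
      obtain ⟨y, rfl, hx⟩ := hz'
      rcases hA y with rfl | ⟨q, rfl⟩
      · rcases hx with rfl | ⟨-, hx⟩
        · exact ⟨Sum.inl (Sum.inl ()), rfl⟩
        · exact ⟨Sum.inl (Sum.inr ⟨x, MixedGraph.mem_parents.2 hx⟩), rfl⟩
      · rcases hx with rfl | ⟨hx, -⟩
        · exact ⟨Sum.inr q, rfl⟩
        · simp [a, expanded_pa_iff hG] at hx
  have hc : Function.Bijective c := by
    constructor
    · rintro ((i | p) | q) ((i' | p') | q') h <;>
        replace h := Prod.ext_iff.1 (congrArg Subtype.val h)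
      · rfl
      · exact absurd h.2 (wp p')
      · exact absurd h.2 (wq q')
      · exact absurd h.2.symm (wp p)
      · rw [Subtype.ext h.2]
      · exact absurd h.1 (sepB q' p)
      · exact absurd h.2.symm (wq q)
      · exact absurd h.1.symm (sepB q p')
      · rw [Subtype.ext h.2]
    · rintro ⟨⟨z, x⟩, hz⟩
      have hz' : ∃ y, Quotient.mk C.mergeB y = z ∧ x ∈ C.labelB y := hz
      obtain ⟨y, rfl, hx⟩ := hz'
      rcases hB y with rfl | ⟨p, rfl⟩
      · rcases hx with rfl | ⟨-, hx⟩
        · exact ⟨Sum.inl (Sum.inl ()), rfl⟩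
        · exact ⟨Sum.inr ⟨x, MixedGraph.mem_parents.2 hx⟩, rfl⟩
      · rcases hx with rfl | ⟨hx, -⟩
        · exact ⟨Sum.inl (Sum.inr p), rfl⟩
        · simp [b, expanded_pa_iff hG] at hx
  have adj : ∀ {x y}, C.Adj x y →
      (output G G.pa v w).Adj (Quotient.mk C.mergeA x) (Quotient.mk C.mergeB y) :=
    fun {x y} h => ⟨x, y, rfl, rfl, h⟩
  have nadj : ∀ q p,
      ¬ (output G G.pa v w).Adj (Quotient.mk C.mergeA (a q)) (Quotient.mk C.mergeB (b p)) := by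
    rintro q p ⟨x, y, hx, hy, h⟩
    rcases hA x with rfl | ⟨q', rfl⟩
    · exact sepA p q hx.symm
    · rcases hB y with rfl | ⟨p', rfl⟩
      · exact sepB q p hy.symm
      · exact adj₀ _ _ h
  refine ⟨Equiv.ofBijective r hr, Equiv.ofBijective c hc, ?_⟩
  ext1 i j
  rcases i with (i | p) | q <;> rcases j with (j | p') | q'
  · exact if_pos (adj adj₁₂)
  · exact if_pos (adj (adj₁ _))
  · exact if_pos (adj adj₁₂)
  · exact if_pos (adj adj₁₂)
  · exact if_pos (adj (adj₁ _))
  · exact if_pos (adj adj₁₂)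
  · exact if_pos (adj (adj₂ _))
  · exact if_neg (nadj _ _)
  · exact if_pos (adj (adj₂ _))

end Construction

/-! ### Linear algebra of `Λ` and `Ω` over a commutative ring -/

namespace MixedGraph

open Matrix

variable {V : Type*}

theorem _root_.CovPoly.isSymm_map_sigma {T : Type*} (f : MvPolynomial (Sym2 V) ℝ → T) :
    ((CovPoly.sigma V).map f).IsSymm := by
  ext i j
  simp [CovPoly.sigma, Sym2.eq_swap]

section Support

variable {T : Type*} [CommRing T] {G : MixedGraph V}

/-- `Λ` is supported on the directed edges. -/
def DirectedSupport (G : MixedGraph V) (L : Matrix V V T) : Prop := ∀ v w, ¬ G.D v w → L v w = 0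

/-- `Ω` is supported on the diagonal and the bidirected edges. -/
def BidirectedSupport (G : MixedGraph V) (O : Matrix V V T) : Prop :=
  ∀ v w, v ≠ w → ¬ G.B.Adj v w → O v w = 0

end Support

section Symbolic

variable (G : MixedGraph V)

open Classical in
/-- The symbolic matrix `Λ`. -/
noncomputable def symbolicL : Matrix V V (MvPolynomial ((V × V) ⊕ Sym2 V) ℝ) :=
  of fun v w => if G.D v w then MvPolynomial.X (Sum.inl (v, w)) else 0

open Classical in
/-- The symbolic matrix `Ω`. -/
noncomputable def symbolicO : Matrix V V (MvPolynomial ((V × V) ⊕ Sym2 V) ℝ) :=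
  of fun v w => if v = w ∨ G.B.Adj v w then MvPolynomial.X (Sum.inr s(v, w)) else 0

theorem directedSupport_symbolicL : G.DirectedSupport G.symbolicL := fun _ _ h => if_neg h

theorem bidirectedSupport_symbolicO : G.BidirectedSupport G.symbolicO :=
  fun _ _ h h' => if_neg (by tauto)

open Classical in
theorem isSymm_symbolicO : G.symbolicO.IsSymm := by
  ext1 i j
  change ite _ _ _ = ite _ _ _
  rw [Sym2.eq_swap]
  exact if_congr (by rw [eq_comm, G.B.adj_comm]) rfl rfl

end Symbolic

variable [Fintype V] {G : MixedGraph V}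

section Ring

variable {T : Type*} [CommRing T]

variable [DecidableEq V] {L S K : Matrix V V T}

theorem DirectedSupport.mul_one_sub_apply (hL : G.DirectedSupport L) (v w : V) :
    (S * (1 - L)) v w = S v w - ∑ q ∈ G.parents w, S v q * L q w := by
  rw [Matrix.mul_sub, Matrix.mul_one, Matrix.sub_apply, Matrix.mul_apply]
  congr 1
  refine (Finset.sum_subset (Finset.subset_univ _) fun x _ hx => ?_).symm
  rw [hL x w (by simpa using hx), mul_zero]

theorem DirectedSupport.one_sub_transpose_mul_apply (hL : G.DirectedSupport L) (v w : V) :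
    ((1 - L)ᵀ * K : Matrix V V T) v w = K v w - ∑ p ∈ G.parents v, L p v * K p w := by
  have h := hL.mul_one_sub_apply (S := Kᵀ) w v
  rw [← Matrix.transpose_apply (_ * _), Matrix.transpose_mul, Matrix.transpose_transpose, h]
  simp [mul_comm]

/-- The number of proper ancestors increases strictly along edges, so `L` is strictly block
triangular for this grading and the diagonal blocks of `1 - L` are identities. -/
theorem DirectedSupport.det_one_sub (hG : G.IsAncestral) (hL : G.DirectedSupport L) :
    (1 - L).det = 1 := by
  classical
  let b : V → ℕ := fun v => (Finset.univ.filter fun u => Relation.TransGen G.D u v).card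
  have hb : ∀ v w, G.D v w → b v < b w := by
    intro v w h
    refine Finset.card_lt_card (Finset.ssubset_iff_of_subset ?_ |>.2 ⟨v, ?_, ?_⟩)
    · intro u hu
      simp only [Finset.mem_filter, Finset.mem_univ, true_and] at hu ⊢
      exact hu.tail h
    · simpa using Relation.TransGen.single h
    · simpa using hG.1 v
  have hz : ∀ v w, b w ≤ b v → L v w = 0 := fun v w h =>
    hL v w fun h' => (hb v w h').not_ge h
  have ht : BlockTriangular (1 - L) b := by
    intro i j hij
    have hne : i ≠ j := by
      rintro rfl
      exact lt_irrefl _ hij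
    simp [hz i j hij.le, Matrix.one_apply_ne hne]
  rw [ht.det]
  refine Finset.prod_eq_one fun k _ => ?_
  have : (1 - L).toSquareBlock b k = 1 := by
    ext i j
    have := hz i j (by rw [i.2, j.2])
    simp [toSquareBlock, toSquareBlockProp, this, Matrix.one_apply, Subtype.ext_iff]
  rw [this, det_one]

/-- In an acyclic graph, entries in ancestral positions vanish by induction along the ancestors. -/
theorem DirectedSupport.eq_zero_of_transGen (hG : G.IsAncestral) (hL : G.DirectedSupport L)
    (h : ∀ v w, Relation.TransGen G.D v w → K v w = 0 ∨ ((1 - L)ᵀ * K : Matrix V V T) v w = 0) {v w : V}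
    (hvw : Relation.TransGen G.D v w) : K v w = 0 ∧ ((1 - L)ᵀ * K : Matrix V V T) v w = 0 := by
  have hwf : WellFounded (Relation.TransGen G.D) :=
    haveI : IsTrans V (Relation.TransGen G.D) := ⟨fun _ _ _ => Relation.TransGen.trans⟩
    haveI : Std.Irrefl (Relation.TransGen G.D) := ⟨hG.1⟩
    Finite.wellFounded_of_trans_of_irrefl _
  induction v using hwf.induction with
  | _ v ih =>
    -- Parents of `v` are again ancestors of `w`, so the correction terms vanish and the entries of
    -- `K` and `(1 - L)ᵀ * K` at `(v, w)` agree.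
    have hsum : ∑ p ∈ G.parents v, L p v * K p w = 0 := by
      refine Finset.sum_eq_zero fun p hp => ?_
      have hpv : Relation.TransGen G.D p v := .single (mem_parents.1 hp)
      rw [(ih p hpv (hpv.trans hvw)).1, mul_zero]
    have h' := hL.one_sub_transpose_mul_apply (K := K) v w
    rw [hsum, sub_zero] at h'
    rcases h v w hvw with h | h
    · exact ⟨h, h'.trans h⟩
    · exact ⟨h'.symm.trans h, h⟩

/-- The polynomial of a non-adjacent pair is, up to minors, the corresponding entry of `Ω`. -/
theorem map_det_hookMatrix_sigma (hL : G.DirectedSupport L)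
    (f : MvPolynomial (Sym2 V) ℝ →+* T)
    (h : ∀ u v, G.D u v → ((CovPoly.sigma V).map f * (1 - L)) u v = 0) (v w : V) :
    f ((CovPoly.sigma V).hookMatrix v w (G.parents v) (G.parents w)).det =
      f (CovPoly.principalMinor (G.parents v)) * f (CovPoly.principalMinor (G.parents w)) *
        ((1 - L)ᵀ * ((CovPoly.sigma V).map f * (1 - L)) : Matrix V V T) v w := by
  have hmap : f.mapMatrix ((CovPoly.sigma V).hookMatrix v w (G.parents v) (G.parents w)) =
      ((CovPoly.sigma V).map f).hookMatrix v w (G.parents v) (G.parents w) := by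
    ext ((i | i) | i) ((j | j) | j) <;> simp [hookMatrix]
  have hsol : ∀ v, ∀ p ∈ G.parents v, (CovPoly.sigma V).map f p v =
      ∑ u ∈ G.parents v, (CovPoly.sigma V).map f p u * L u v := by
    intro v p hp
    have := h p v (mem_parents.1 hp)
    rwa [hL.mul_one_sub_apply, sub_eq_zero] at this
  rw [RingHom.map_det, hmap, det_hookMatrix _ (CovPoly.isSymm_map_sigma f) v w _ _ (fun u => L u v) (fun u => L u w)
    (hsol v) (hsol w), CovPoly.principalMinor, CovPoly.principalMinor, RingHom.map_det,
    RingHom.map_det, hL.one_sub_transpose_mul_apply, hL.mul_one_sub_apply]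
  simp only [hL.mul_one_sub_apply]
  rfl

/-- The required vanishing on edges into `v` is a linear system for column `v` of `L`, whose matrix
is the parent block of `v`. -/
theorem exists_directedSupport (f : MvPolynomial (Sym2 V) ℝ →+* T)
    (hf : ∀ v, IsUnit (f (CovPoly.principalMinor (G.parents v)))) :
    ∃ L : Matrix V V T, G.DirectedSupport L ∧
      ∀ u v, G.D u v → ((CovPoly.sigma V).map f * (1 - L)) u v = 0 := by
  classical
  let P : ∀ v, Matrix (G.parents v) (G.parents v) T :=
    fun v => ((CovPoly.sigma V).map f).submatrix (fun i => i) (fun i => i)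
  have hP : ∀ v, IsUnit (P v).det := by
    intro v
    have h := hf v
    rw [CovPoly.principalMinor, RingHom.map_det] at h
    exact h
  let x : ∀ v, G.parents v → T :=
    fun v => (P v)⁻¹ *ᵥ fun p : G.parents v => (CovPoly.sigma V).map f p v
  let L : Matrix V V T := of fun u v => if h : u ∈ G.parents v then x v ⟨u, h⟩ else 0
  have hL : G.DirectedSupport L := fun v w h => dif_neg (by simpa using h)
  refine ⟨L, hL, fun u v h => ?_⟩
  have hx : P v *ᵥ x v = fun p : G.parents v => (CovPoly.sigma V).map f p v := by
    rw [Matrix.mulVec_mulVec, Matrix.mul_nonsing_inv _ (hP v), Matrix.one_mulVec]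
  rw [hL.mul_one_sub_apply, sub_eq_zero, ← Finset.sum_coe_sort]
  refine (congrFun hx ⟨u, mem_parents.2 h⟩).symm.trans (Finset.sum_congr rfl fun p _ => ?_)
  have : L p v = x v p := dif_pos p.2
  rw [this]
  rfl

end Ring

/-! ### The symbolic parametrization -/

section Parametrization

variable [DecidableEq V] (G)

/-- The symbolic covariance matrix `(1 - Λ)⁻ᵀ Ω (1 - Λ)⁻¹`. -/
noncomputable def symbolicCov : Matrix V V (MvPolynomial ((V × V) ⊕ Sym2 V) ℝ) :=
  (1 - G.symbolicL).adjugateᵀ * G.symbolicO * (1 - G.symbolicL).adjugate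

theorem isSymm_symbolicCov : G.symbolicCov.IsSymm := by
  simp only [symbolicCov, IsSymm, Matrix.transpose_mul, Matrix.transpose_transpose,
    G.isSymm_symbolicO.eq, Matrix.mul_assoc]

/-- The ring map dual to the parametrization of the model. -/
noncomputable def paramHom :
    MvPolynomial (Sym2 V) ℝ →ₐ[ℝ] MvPolynomial ((V × V) ⊕ Sym2 V) ℝ :=
  MvPolynomial.aeval fun z =>
    Sym2.lift ⟨fun v w => G.symbolicCov v w, fun v w => G.isSymm_symbolicCov.apply w v⟩ z

theorem paramHom_X (v w : V) : G.paramHom (MvPolynomial.X s(v, w)) = G.symbolicCov v w := by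
  simp [paramHom]

variable {G} {T : Type*} [CommRing T]

/-- The adjugate is polynomial and commutes with every ring map; it is the inverse of `1 - Λ`
because the determinant is 1. -/
theorem map_symbolicCov (f : MvPolynomial ((V × V) ⊕ Sym2 V) ℝ →+* T) :
    G.symbolicCov.map f = (1 - G.symbolicL.map f).adjugateᵀ * G.symbolicO.map f *
      (1 - G.symbolicL.map f).adjugate := by
  have h : f.mapMatrix (1 - G.symbolicL).adjugate = (1 - G.symbolicL.map f).adjugate := by
    rw [RingHom.map_adjugate, map_sub, map_one]
    rfl
  rw [← h]
  change f.mapMatrix _ = _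
  rw [symbolicCov, map_mul, map_mul]
  rfl

theorem adjugate_mul_cancel {L S : Matrix V V T} (hL : (1 - L).det = 1) :
    (1 - L).adjugateᵀ * ((1 - L)ᵀ * (S * (1 - L))) * (1 - L).adjugate = S := by
  have h₁ : (1 - L).adjugateᵀ * (1 - L)ᵀ = 1 := by
    rw [← Matrix.transpose_mul, Matrix.mul_adjugate, hL, one_smul, Matrix.transpose_one]
  have h₂ : (1 - L) * (1 - L).adjugate = 1 := by
    rw [Matrix.mul_adjugate, hL, one_smul]
  rw [← Matrix.mul_assoc, h₁, Matrix.one_mul, Matrix.mul_assoc, h₂, Matrix.mul_one]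

/-- A point of the symbolic covariance cone over any algebra that has the shape prescribed by `G`
factors through the parametrization. -/
theorem exists_factor_paramHom [Algebra ℝ T] (hG : G.IsAncestral)
    (f : MvPolynomial (Sym2 V) ℝ →ₐ[ℝ] T) {L : Matrix V V T} (hL : G.DirectedSupport L)
    (hO : G.BidirectedSupport ((1 - L)ᵀ * ((CovPoly.sigma V).map f * (1 - L)))) :
    ∃ g : MvPolynomial ((V × V) ⊕ Sym2 V) ℝ →ₐ[ℝ] T, f = g.comp G.paramHom := by
  set O := (1 - L)ᵀ * ((CovPoly.sigma V).map f * (1 - L)) with hOdef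
  have hsymm : O.IsSymm := by
    simp only [hOdef, IsSymm, Matrix.transpose_mul, Matrix.transpose_transpose, (CovPoly.isSymm_map_sigma f).eq,
      Matrix.mul_assoc]
  let g : MvPolynomial ((V × V) ⊕ Sym2 V) ℝ →ₐ[ℝ] T := MvPolynomial.aeval
    (Sum.elim (fun p => L p.1 p.2)
      (fun z => Sym2.lift ⟨fun v w => O v w, fun v w => hsymm.apply w v⟩ z))
  have hgL : G.symbolicL.map g = L := by
    ext i j
    by_cases h : G.D i j
    · simp [symbolicL, h, g]
    · simp [symbolicL, h, hL i j h]
  have hgO : G.symbolicO.map g = O := by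
    ext i j
    by_cases h : i = j ∨ G.B.Adj i j
    · simp [symbolicO, h, g]
    · rw [hO i j (by tauto) (by tauto)]
      simp [symbolicO, h]
  refine ⟨g, MvPolynomial.algHom_ext fun z => ?_⟩
  induction z using Sym2.ind with
  | _ v w =>
    have h := map_symbolicCov (G := G) (g : MvPolynomial ((V × V) ⊕ Sym2 V) ℝ →+* T)
    simp only [RingHom.coe_coe, hgL, hgO] at h
    rw [hOdef, adjugate_mul_cancel (hL.det_one_sub hG)] at h
    have := congrFun (congrFun h v) w
    rw [AlgHom.comp_apply, paramHom_X]
    exact this.symm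

end Parametrization

end MixedGraph

/-! ### The vanishing ideal of the model as a saturation of the constraint ideal -/

namespace MixedGraph

open Matrix MvPolynomial

theorem _root_.CovPoly.map_sigma_aeval {V : Type*} (x : Sym2 V → ℝ) :
    (CovPoly.sigma V).map (aeval x : MvPolynomial (Sym2 V) ℝ →ₐ[ℝ] ℝ) = CovPoly.toMatrix x := by
  ext i j
  simp [CovPoly.sigma, CovPoly.toMatrix]

theorem _root_.CovPoly.aeval_principalMinor_ne_zero {V : Type*} [DecidableEq V] {x : Sym2 V → ℝ}
    (hx : x ∈ CovPoly.posDefCone V) (S : Finset V) : aeval x (CovPoly.principalMinor S) ≠ 0 := by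
  have h := (Matrix.PosDef.submatrix (e := fun i : S => (i : V)) hx Subtype.val_injective).det_pos.ne'
  rw [← CovPoly.map_sigma_aeval x] at h
  rw [CovPoly.principalMinor, AlgHom.map_det]
  exact h

variable {V : Type*} [Fintype V] [DecidableEq V] {G : MixedGraph V}

theorem det_hookMatrix_mem_constraintIdeal (hG : G.IsAncestral) {v w : V} (hne : v ≠ w)
    (hB : ¬ G.B.Adj v w) (hvw : ¬ G.D v w) (hwv : ¬ G.D w v) :
    ((CovPoly.sigma V).hookMatrix v w (G.parents v) (G.parents w)).det ∈
      G.constraintIdeal G.pa := by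
  obtain ⟨r, c, h⟩ := Construction.exists_output_matrix_eq hG hvw hwv
  rw [← h]
  exact Ideal.subset_span ⟨v, w, hne, hB, hvw, hwv,
    GraphicalConstraint.represents_det_submatrix r c⟩

theorem constraintIdeal_le (hG : G.IsAncestral) {J : Ideal (MvPolynomial (Sym2 V) ℝ)}
    (h : ∀ v w, v ≠ w → ¬ G.B.Adj v w →
      ((CovPoly.sigma V).hookMatrix v w (G.parents v) (G.parents w)).det ∈ J) :
    G.constraintIdeal G.pa ≤ J := by
  refine Ideal.span_le.2 ?_
  rintro f ⟨v, w, hne, hB, hvw, hwv, hf⟩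
  obtain ⟨r, c, hrc⟩ := Construction.exists_output_matrix_eq hG hvw hwv
  have h := h v w hne hB
  rcases hf.eq_or_neg r c with rfl | rfl
  · rwa [hrc]
  · rw [hrc]
    exact J.neg_mem h

/-- Where the minors of the parent sets are invertible, every solution of the constraints factors
through the parametrization. -/
theorem exists_factor_paramHom_of_constraintIdeal {T : Type*} [CommRing T] [Algebra ℝ T]
    (hG : G.IsAncestral) (f : MvPolynomial (Sym2 V) ℝ →ₐ[ℝ] T)
    (hI : ∀ p ∈ G.constraintIdeal G.pa, f p = 0)
    (hf : ∀ v, IsUnit (f (CovPoly.principalMinor (G.parents v)))) :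
    ∃ g : MvPolynomial ((V × V) ⊕ Sym2 V) ℝ →ₐ[ℝ] T, f = g.comp G.paramHom := by
  obtain ⟨L, hL, hK⟩ := exists_directedSupport (G := G) (f : MvPolynomial (Sym2 V) ℝ →+* T) hf
  refine exists_factor_paramHom hG f hL ?_
  have hcon : ∀ v w, v ≠ w → ¬ G.B.Adj v w → ¬ G.D v w → ¬ G.D w v →
      ((1 - L)ᵀ * ((CovPoly.sigma V).map f * (1 - L)) : Matrix V V T) v w = 0 := by
    intro v w hne hB hvw hwv
    have h := hI _ (det_hookMatrix_mem_constraintIdeal hG hne hB hvw hwv)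
    have h' := map_det_hookMatrix_sigma hL (f : MvPolynomial (Sym2 V) ℝ →+* T) hK v w
    exact (((hf v).mul (hf w)).mul_right_eq_zero).1 (h'.symm.trans h)
  -- The construction gives no constraint for a directed edge. There the normal equations kill `Σ (1
  -- - L)`, at other ancestral pairs the constraints kill `Ω`, and the induction yields both.
  have hanc : ∀ v w, Relation.TransGen G.D v w →
      ((1 - L)ᵀ * ((CovPoly.sigma V).map f * (1 - L)) : Matrix V V T) v w = 0 := by
    intro v w hvw
    refine (hL.eq_zero_of_transGen hG (fun v w hvw => ?_) hvw).2
    by_cases hD : G.D v w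
    · exact Or.inl (hK v w hD)
    · refine Or.inr (hcon v w ?_ (fun h => hG.2 v w h hvw) hD fun h => hG.1 v (hvw.tail h))
      rintro rfl
      exact hG.1 v hvw
  have hsymm : ((1 - L)ᵀ * ((CovPoly.sigma V).map f * (1 - L))).IsSymm := by
    simp only [IsSymm, Matrix.transpose_mul, Matrix.transpose_transpose,
      (CovPoly.isSymm_map_sigma f).eq, Matrix.mul_assoc]
  intro v w hne hB
  by_cases hvw : G.D v w
  · exact hanc v w (.single hvw)
  · by_cases hwv : G.D w v
    · rw [← hsymm.apply]
      exact hanc w v (.single hwv)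
    · exact hcon v w hne hB hvw hwv

theorem model_subset_posDefCone : G.model ⊆ CovPoly.posDefCone V := by
  rintro x ⟨L, O, -, hL, -, hO, hx⟩
  change (CovPoly.toMatrix x).PosDef
  rw [hx]
  have h := hO.conjTranspose_mul_mul_same (B := (1 - L)⁻¹)
    (Matrix.mulVec_injective_of_isUnit ((Matrix.isUnit_nonsing_inv_iff).2 hL))
  simpa [Matrix.conjTranspose_eq_transpose_of_trivial] using h

theorem model_nonempty : G.model.Nonempty := by
  refine ⟨Sym2.lift ⟨fun v w => (1 : Matrix V V ℝ) v w, fun v w => ?_⟩, 0, 1, ?_, ?_, ?_,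
    Matrix.PosDef.one, ?_⟩
  · simp [Matrix.one_apply, eq_comm]
  · simp
  · simp
  · intro v w h _
    exact Matrix.one_apply_ne h
  · ext i j
    simp [CovPoly.toMatrix]

theorem aeval_eq_zero_of_mem_constraintIdeal (hG : G.IsAncestral) {x : Sym2 V → ℝ}
    (hx : x ∈ G.model) {p : MvPolynomial (Sym2 V) ℝ} (hp : p ∈ G.constraintIdeal G.pa) :
    aeval x p = 0 := by
  suffices h : G.constraintIdeal G.pa ≤ RingHom.ker (aeval x : MvPolynomial (Sym2 V) ℝ →ₐ[ℝ] ℝ) from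
    h hp
  obtain ⟨L, O, hL, -, hO, -, hx⟩ := hx
  have hL : G.DirectedSupport L := hL
  have hdet := hL.det_one_sub hG
  have hSO : (1 - L)ᵀ * (CovPoly.toMatrix x * (1 - L)) = O := by
    have hu : IsUnit (1 - L).det := by simp [hdet]
    rw [hx, Matrix.mul_assoc _ _ (1 - L), Matrix.nonsing_inv_mul _ hu, Matrix.mul_one,
      ← Matrix.mul_assoc, ← Matrix.transpose_mul, Matrix.nonsing_inv_mul _ hu,
      Matrix.transpose_one, Matrix.one_mul]
  -- Here the induction runs from `Ω`: ancestrality puts no bidirected edge on an ancestral pair, so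
  -- `Ω` vanishes there.
  have hK : ∀ u v, G.D u v → (CovPoly.toMatrix x * (1 - L)) u v = 0 := by
    intro u v huv
    refine (hL.eq_zero_of_transGen hG (fun v w hvw => Or.inr ?_) (.single huv)).1
    rw [hSO]
    refine hO v w ?_ fun h => hG.2 v w h hvw
    rintro rfl
    exact hG.1 v hvw
  refine constraintIdeal_le hG fun v w hne hB => ?_
  have h := map_det_hookMatrix_sigma hL
    ((aeval x : MvPolynomial (Sym2 V) ℝ →ₐ[ℝ] ℝ) : MvPolynomial (Sym2 V) ℝ →+* ℝ)
    (by rw [RingHom.coe_coe, CovPoly.map_sigma_aeval]; exact hK) v w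
  rw [RingHom.coe_coe, CovPoly.map_sigma_aeval, hSO, hO v w hne hB, mul_zero] at h
  exact h

/-- Diagonal dominance: `2|x_i x_j| ≤ x_i² + x_j²` summed over all pairs costs `card V` times `∑
x_i²`, so the quadratic form is at least `∑ x_i²`. -/
theorem _root_.Matrix.PosDef.of_card_add_one_le_diag {O : Matrix V V ℝ} (hO : O.IsSymm)
    (hdiag : ∀ i, (Fintype.card V : ℝ) + 1 ≤ O i i) (hoff : ∀ i j, i ≠ j → |O i j| ≤ 1) :
    O.PosDef := by
  refine Matrix.PosDef.of_dotProduct_mulVec_pos ?_ fun x hx => ?_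
  · rw [IsHermitian, Matrix.conjTranspose_eq_transpose_of_trivial, hO.eq]
  · have hpos : 0 < ∑ i, x i ^ 2 := by
      obtain ⟨i, hi⟩ := Function.ne_iff.1 hx
      exact Finset.sum_pos' (fun _ _ => sq_nonneg _) ⟨i, Finset.mem_univ _, sq_pos_of_ne_zero hi⟩
    refine hpos.trans_le ?_
    have hterm : ∀ i j, (if i = j then (Fintype.card V + 1) * x i ^ 2 else 0) -
        (x i ^ 2 / 2 + x j ^ 2 / 2) ≤ x i * (O i j * x j) := by
      intro i j
      split_ifs with h
      · subst h
        nlinarith [hdiag i, sq_nonneg (x i), mul_le_mul_of_nonneg_right (hdiag i) (sq_nonneg (x i))]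
      · have h1 := abs_le.1 (hoff i j h)
        nlinarith [mul_nonneg (sub_nonneg.2 h1.2) (sq_nonneg (x i - x j)),
          mul_nonneg (neg_le_iff_add_nonneg.1 h1.1) (sq_nonneg (x i + x j))]
    have hsum := Finset.sum_le_sum fun i (_ : i ∈ Finset.univ) =>
      Finset.sum_le_sum fun j (_ : j ∈ Finset.univ) => hterm i j
    have hleft : ∑ i, ∑ j, ((if i = j then (Fintype.card V + 1) * x i ^ 2 else 0) -
        (x i ^ 2 / 2 + x j ^ 2 / 2)) = ∑ i, x i ^ 2 := by
      simp only [Finset.sum_sub_distrib, Finset.sum_add_distrib, Finset.sum_ite_eq,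
        Finset.mem_univ, if_true, Finset.sum_const, Finset.card_univ, nsmul_eq_mul,
        ← Finset.mul_sum, ← Finset.sum_div]
      ring
    rw [hleft] at hsum
    refine hsum.trans_eq ?_
    simp [dotProduct, mulVec, Finset.mul_sum]

/-- The parameters of the model contain a product of infinite sets, on which only the zero
polynomial vanishes: `Λ` is free, and a large diagonal keeps `Ω` positive definite. -/
theorem paramHom_eq_zero_of_mem_vanishingIdeal (hG : G.IsAncestral)
    {p : MvPolynomial (Sym2 V) ℝ} (hp : p ∈ vanishingIdeal ℝ G.model) : G.paramHom p = 0 := by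
  classical
  let s : (V × V) ⊕ Sym2 V → Set ℝ := Sum.elim (fun _ => Set.univ)
    (fun z => if z.IsDiag then Set.Ici (Fintype.card V + 1) else Set.Icc 0 1)
  have hs : ∀ i, (s i).Infinite := by
    rintro (i | z)
    · exact Set.infinite_univ
    · by_cases h : z.IsDiag
      · simpa [s, h] using Set.Ici_infinite _
      · simpa [s, h] using Set.Icc_infinite (zero_lt_one' ℝ)
  refine funext_set s hs fun y hy => ?_
  obtain ⟨e, he⟩ : ∃ e : MvPolynomial ((V × V) ⊕ Sym2 V) ℝ →ₐ[ℝ] ℝ, e = aeval y := ⟨_, rfl⟩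
  let x : Sym2 V → ℝ := fun z => e (G.paramHom (X z))
  have hx : (aeval x : MvPolynomial (Sym2 V) ℝ →ₐ[ℝ] ℝ) = e.comp G.paramHom :=
    MvPolynomial.algHom_ext fun z => by simp [x]
  have hL : G.DirectedSupport (G.symbolicL.map e) := fun v w h => by
    simp [G.directedSupport_symbolicL v w h]
  have hdet := hL.det_one_sub hG
  have hmem : x ∈ G.model := by
    refine ⟨G.symbolicL.map e, G.symbolicO.map e, hL, ?_, fun v w h h' => ?_, ?_, ?_⟩
    · rw [Matrix.isUnit_iff_isUnit_det, hdet]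
      exact isUnit_one
    · simp [G.bidirectedSupport_symbolicO v w h h']
    · refine Matrix.PosDef.of_card_add_one_le_diag ?_ (fun i => ?_) fun i j h => ?_
      · rw [IsSymm, ← Matrix.transpose_map, G.isSymm_symbolicO.eq]
      · have := hy (Sum.inr s(i, i)) (Set.mem_univ _)
        simpa [s, symbolicO, he] using this
      · have := hy (Sum.inr s(i, j)) (Set.mem_univ _)
        simp only [s, Sum.elim_inr, Sym2.mk_isDiag_iff, h, if_false, Set.mem_Icc] at this
        by_cases hB : G.B.Adj i j
        · simpa [symbolicO, hB, he, abs_of_nonneg this.1] using this.2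
        · simp [G.bidirectedSupport_symbolicO i j h hB]
    · have hinv : (1 - G.symbolicL.map e)⁻¹ = (1 - G.symbolicL.map e).adjugate := by
        simp [Matrix.inv_def, hdet]
      have hcov := map_symbolicCov (G := G)
        (e : MvPolynomial ((V × V) ⊕ Sym2 V) ℝ →+* ℝ)
      rw [RingHom.coe_coe] at hcov
      rw [hinv, ← hcov]
      ext i j
      simp [CovPoly.toMatrix, x, paramHom_X]
  have h := hp x hmem
  rw [hx] at h
  rw [map_zero, ← MvPolynomial.coe_aeval_eq_eval, ← he]
  exact h

/-- The vanishing ideal of the model is the saturation of the constraint ideal. -/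
theorem mem_vanishingIdeal_model_iff (hG : G.IsAncestral) (p : MvPolynomial (Sym2 V) ℝ) :
    p ∈ vanishingIdeal ℝ G.model ↔
      ∃ n : ℕ, (∏ v, CovPoly.principalMinor (G.parents v)) ^ n * p ∈ G.constraintIdeal G.pa := by
  constructor
  · intro hp
    let I := G.constraintIdeal G.pa
    let s : MvPolynomial (Sym2 V) ℝ := ∏ v, CovPoly.principalMinor (G.parents v)
    -- The factorization is applied to the universal solution with `s` invertible; vanishing in the
    -- localization means that a power of `s` multiplies `p` into `I`.
    let A := Localization.Away (Ideal.Quotient.mk I s)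
    let f : MvPolynomial (Sym2 V) ℝ →ₐ[ℝ] A :=
      (IsScalarTower.toAlgHom ℝ (MvPolynomial (Sym2 V) ℝ ⧸ I) A).comp (Ideal.Quotient.mkₐ ℝ I)
    have hfs : IsUnit (f s) := IsLocalization.Away.algebraMap_isUnit (S := A) (Ideal.Quotient.mk I s)
    obtain ⟨g, hg⟩ := exists_factor_paramHom_of_constraintIdeal hG f
      (fun q hq => by
        have : Ideal.Quotient.mk I q = 0 := Ideal.Quotient.eq_zero_iff_mem.2 hq
        simp [f, this])
      (fun v => isUnit_of_dvd_unit (map_dvd f (Finset.dvd_prod_of_mem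
        (fun v => CovPoly.principalMinor (G.parents v)) (Finset.mem_univ v))) hfs)
    have h0 : f p = 0 := by
      rw [hg, AlgHom.comp_apply, paramHom_eq_zero_of_mem_vanishingIdeal hG hp, map_zero]
    have h1 : algebraMap (MvPolynomial (Sym2 V) ℝ ⧸ I) A (Ideal.Quotient.mk I p) = 0 := h0
    obtain ⟨⟨_, n, rfl⟩, hn⟩ := (IsLocalization.map_eq_zero_iff
      (Submonoid.powers (Ideal.Quotient.mk I s)) A _).1 h1
    refine ⟨n, Ideal.Quotient.eq_zero_iff_mem.1 ?_⟩
    rw [map_mul, map_pow]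
    exact hn
  · rintro ⟨n, hn⟩ x hx
    have h := aeval_eq_zero_of_mem_constraintIdeal hG hx hn
    rw [map_mul, map_pow, map_prod] at h
    refine (mul_eq_zero.1 h).resolve_left (pow_ne_zero _ (Finset.prod_ne_zero_iff.2 fun v _ => ?_))
    exact CovPoly.aeval_principalMinor_ne_zero (model_subset_posDefCone hx) _

/-- The vanishing ideal is the kernel of a map to a domain: evaluation at each point of the model
factors through `paramHom`. -/
theorem isPrime_vanishingIdeal_model (hG : G.IsAncestral) :
    (vanishingIdeal ℝ G.model : Ideal (MvPolynomial (Sym2 V) ℝ)).IsPrime := by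
  have h : ∀ p, p ∈ vanishingIdeal ℝ G.model ↔ p ∈ RingHom.ker G.paramHom := by
    intro p
    refine ⟨fun hp => paramHom_eq_zero_of_mem_vanishingIdeal hG hp, fun hp x hx => ?_⟩
    obtain ⟨g, hg⟩ := exists_factor_paramHom_of_constraintIdeal hG
      (aeval x : MvPolynomial (Sym2 V) ℝ →ₐ[ℝ] ℝ)
      (fun q hq => aeval_eq_zero_of_mem_constraintIdeal hG hx hq)
      (fun v => (CovPoly.aeval_principalMinor_ne_zero (model_subset_posDefCone hx) _).isUnit)
    have hp' : G.paramHom p = 0 := hp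
    rw [hg, AlgHom.comp_apply, hp', map_zero]
  rw [Ideal.ext h]
  exact RingHom.ker_isPrime _

end MixedGraph

theorem mainTheorem2 {V : Type*} [Fintype V] [DecidableEq V] (G : MixedGraph V)
    (hG : G.IsAncestral) :
    G.IsPDPrimary (G.constraintIdeal G.pa) ∧
    ∀ t : Finset (Ideal (MvPolynomial (Sym2 V) ℝ)),
      Submodule.IsMinimalPrimaryDecomposition (G.constraintIdeal G.pa) t →
        (∃! Q, Q ∈ t ∧ MvPolynomial.zeroLocus ℝ Q = G.algebraicModel) ∧
        ∀ Q ∈ t, G.IsSpurious Q →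
          Disjoint (MvPolynomial.zeroLocus ℝ Q) (CovPoly.posDefCone V) := by
  have key : ∀ t : Finset (Ideal (MvPolynomial (Sym2 V) ℝ)),
      Submodule.IsMinimalPrimaryDecomposition (G.constraintIdeal G.pa) t →
      MvPolynomial.vanishingIdeal ℝ G.model ∈ t ∧
        ∀ Q ∈ t, Q ≠ MvPolynomial.vanishingIdeal ℝ G.model →
          ∃ S : Finset V, S.Nonempty ∧ ∃ k : ℕ, 1 ≤ k ∧ CovPoly.principalMinor S ^ k ∈ Q := by
    intro t ht
    obtain ⟨hmem, hrad⟩ := ht.mem_and_mem_radical_of_saturation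
      (MixedGraph.isPrime_vanishingIdeal_model hG) (MixedGraph.mem_vanishingIdeal_model_iff hG)
    refine ⟨hmem, fun Q hQ hne => ?_⟩
    have hprime := Ideal.isPrime_radical (ht.primary hQ)
    obtain ⟨v, -, k, hk⟩ := (hprime.prod_mem_iff).1 (hrad Q hQ hne)
    have hk' : CovPoly.principalMinor (G.parents v) ^ (k + 1) ∈ Q := by
      rw [pow_succ]
      exact Q.mul_mem_right _ hk
    refine ⟨G.parents v, ?_, k + 1, Nat.le_add_left 1 k, hk'⟩
    -- The empty minor is 1, which would lie in the proper ideal `Q`.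
    by_contra hempty
    rw [Finset.not_nonempty_iff_eq_empty] at hempty
    rw [hempty, CovPoly.principalMinor, Matrix.det_isEmpty, one_pow] at hk'
    exact (ht.primary hQ).1 ((Ideal.eq_top_iff_one _).2 hk')
  have hdisj : ∀ Q : Ideal (MvPolynomial (Sym2 V) ℝ), (∃ S : Finset V, S.Nonempty ∧
      ∃ k : ℕ, 1 ≤ k ∧ CovPoly.principalMinor S ^ k ∈ Q) →
      Disjoint (MvPolynomial.zeroLocus ℝ Q) (CovPoly.posDefCone V) := by
    rintro Q ⟨S, -, k, -, hk⟩
    refine Set.disjoint_left.2 fun x hx hpd => ?_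
    have h := hx _ hk
    rw [map_pow] at h
    exact CovPoly.aeval_principalMinor_ne_zero hpd S (eq_zero_of_pow_eq_zero h)
  have hspur : ∀ Q : Ideal (MvPolynomial (Sym2 V) ℝ), G.IsSpurious Q →
      Q ≠ MvPolynomial.vanishingIdeal ℝ G.model := by
    rintro Q hQ rfl
    exact hQ rfl
  refine ⟨fun t ht Q hQ hsp => (key t ht).2 Q hQ (hspur Q hsp), fun t ht => ⟨?_, ?_⟩⟩
  · refine ⟨_, ⟨(key t ht).1, rfl⟩, ?_⟩
    rintro Q ⟨hQ, hZ⟩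
    by_contra hne
    -- A second component with the same variety would contain a positive definite point of the
    -- model.
    obtain ⟨x, hx⟩ := MixedGraph.model_nonempty (G := G)
    have hxQ : x ∈ MvPolynomial.zeroLocus ℝ Q := by
      rw [hZ]
      exact MvPolynomial.zeroLocus_vanishingIdeal_le _ hx
    exact Set.disjoint_left.1 (hdisj Q ((key t ht).2 Q hQ hne)) hxQ
      (MixedGraph.model_subset_posDefCone hx)
  · exact fun Q hQ hsp => hdisj Q ((key t ht).2 Q hQ (hspur Q hsp))
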